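/- Call a random variable $X$ infinitely divisible if for every integer $n\ge 1$ its distribution is the distribution of a sum of $n$ independent identically distributed real random variables. Let $\mathcal I$ be the class of all infinitely divisible real random variables $X$ (on arbitrary probability spaces) with $E[X^2]<\infty$, and let $\mathcal I_0=\{X\in\mathcal I:\operatorname{Var}(X)>0\}$. Put $$P_{\mathcal I}=\inf_{X\in\mathcal I}P\left\{|X-E[X]|\le\sqrt{\operatorname{Var}(X)}\right\},\qquad P_{\mathcal I_0}=\inf_{X\in\mathcal I_0}P\left\{|X-E[X]|<\sqrt{\operatorname{Var}(X)}\right\}.$$ Then $P_{\mathcal I}\ge P_{\mathcal I_0}>0$. Moreover, there exists $Y\in\mathcal I_0$ such that $$P_{\mathcal I_0}=P\left\{|Y-E[Y]|<\sqrt{\operatorname{Var}(Y)}\right\}.$$ -/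

import Mathlib

open MeasureTheory ProbabilityTheory

universe u

/-- A distribution `μ` on `ℝ` is infinitely divisible if for every `n ≥ 1` it is the distribution
of a sum of `n` i.i.d. real random variables (realised as the coordinates on the product space). -/
def IsInfinitelyDivisible (μ : Measure ℝ) : Prop :=
  ∀ n : ℕ, 1 ≤ n → ∃ ν : Measure ℝ, IsProbabilityMeasure ν ∧
    (Measure.pi (fun _ : Fin n => ν)).map (fun x => ∑ i, x i) = μ

/-- `X` is a real random variable on `(Ω, P)` with infinitely divisible law and finite second
moment, i.e. `X` belongs to the class `𝓘`. -/
structure InfDivL2 {Ω : Type u} [MeasurableSpace Ω] (X : Ω → ℝ) (P : Measure Ω) : Prop where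
  measurable : Measurable X
  memLp_two : MemLp X 2 P
  infinitelyDivisible : IsInfinitelyDivisible (P.map X)

/-- `X` belongs to the class `𝓘₀`: a member of `𝓘` with positive variance. -/
structure InfDivL2Pos {Ω : Type u} [MeasurableSpace Ω] (X : Ω → ℝ) (P : Measure Ω) : Prop
    extends InfDivL2 X P where
  variance_pos : 0 < variance X P

/-- `P{|X - E[X]| ≤ √Var(X)}`. -/
noncomputable def probLe {Ω : Type u} [MeasurableSpace Ω] (X : Ω → ℝ) (P : Measure Ω) : ℝ :=
  P.real {ω | |X ω - ∫ ω', X ω' ∂P| ≤ √(variance X P)}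

/-- `P{|X - E[X]| < √Var(X)}`. -/
noncomputable def probLt {Ω : Type u} [MeasurableSpace Ω] (X : Ω → ℝ) (P : Measure Ω) : ℝ :=
  P.real {ω | |X ω - ∫ ω', X ω' ∂P| < √(variance X P)}

/-- The infimum of `P{|X - E[X]| ≤ √Var(X)}` over all `X ∈ 𝓘`, on arbitrary probability spaces
(in a given universe). The set of values is bounded below by `0`. -/
noncomputable def infProbLe : ℝ :=
  sInf {p : ℝ | ∃ (Ω : Type u) (_ : MeasurableSpace Ω) (P : Measure Ω) (X : Ω → ℝ),
    IsProbabilityMeasure P ∧ InfDivL2 X P ∧ p = probLe X P}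

/-- The infimum of `P{|X - E[X]| < √Var(X)}` over all `X ∈ 𝓘₀`, on arbitrary probability spaces
(in a given universe). The set of values is bounded below by `0`. -/
noncomputable def infProbLt : ℝ :=
  sInf {p : ℝ | ∃ (Ω : Type u) (_ : MeasurableSpace Ω) (P : Measure Ω) (X : Ω → ℝ),
    IsProbabilityMeasure P ∧ InfDivL2Pos X P ∧ p = probLt X P}

open Filter Topology Set

/-! Standardizing reduces `probLt` to the mass of `(-1, 1)` under an infinitely divisible law with
mean 0 and second moment 1. Such laws are tight, so a minimizing sequence converges weakly along an
ultrafilter to some `μ`. Infinite divisibility passes to the limit because the convolution roots are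
tight too (`isInfinitelyDivisible_of_tendsto`); bounded second moments keep the mean at 0, and the
second moment `s` of `μ` is at most 1. By portmanteau `μ (-1, 1)` is at most the infimum.

Variance may be lost in the limit. If `0 < s ≤ 1`, the interval `|x| < √s` lies in `(-1, 1)`, so `μ`
attains the infimum. If `s = 0`, then `μ` is the Dirac mass at 0, the infimum is 1 and every member
attains it.

Positivity then concerns a single law: without mass in `(-1, 1)` it would live on `{-1, 1}`, but a
bounded infinitely divisible law is degenerate (`variance_eq_zero_of_bounded`). -/

/-! ### Convolution roots: characteristic functions, affine images, tails. -/

theorem measurable_sum_coords (n : ℕ) : Measurable (fun x : Fin n → ℝ => ∑ i, x i) :=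
  Finset.measurable_sum _ fun i _ => measurable_pi_apply i

theorem isInfinitelyDivisible_of_charFun {μ : Measure ℝ} [IsProbabilityMeasure μ]
    (h : ∀ n : ℕ, 1 ≤ n → ∃ ν : Measure ℝ, IsProbabilityMeasure ν ∧
      ∀ t, charFun ν t ^ n = charFun μ t) : IsInfinitelyDivisible μ := by
  intro n hn
  obtain ⟨ν, hν, hνμ⟩ := h n hn
  refine ⟨ν, hν, ?_⟩
  have := Measure.isProbabilityMeasure_map (μ := Measure.pi (fun _ : Fin n => ν))
    (measurable_sum_coords n).aemeasurable
  refine Measure.ext_of_charFun (funext fun t => ?_)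
  rw [charFun_map_sum_pi_eq_prod]
  simp [hνμ]

theorem charFun_pow_of_map_sum {n : ℕ} {ν μ : Measure ℝ} [IsProbabilityMeasure ν]
    (h : (Measure.pi (fun _ : Fin n => ν)).map (fun x => ∑ i, x i) = μ) (t : ℝ) :
    charFun ν t ^ n = charFun μ t := by
  rw [← h, charFun_map_sum_pi_eq_prod]
  simp

theorem isInfinitelyDivisible_gaussianReal : IsInfinitelyDivisible (gaussianReal 0 1) := by
  refine isInfinitelyDivisible_of_charFun fun n hn => ⟨gaussianReal 0 (1 / n), inferInstance, ?_⟩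
  intro t
  have hn' : (n : ℂ) ≠ 0 := by exact_mod_cast (by omega : n ≠ 0)
  rw [charFun_gaussianReal, charFun_gaussianReal, ← Complex.exp_nat_mul]
  congr 1
  push_cast
  field_simp
  simp

theorem IsInfinitelyDivisible.map_affine {μ : Measure ℝ} (h : IsInfinitelyDivisible μ) (a b : ℝ) :
    IsInfinitelyDivisible (μ.map fun x => a * x + b) := by
  intro n hn
  obtain ⟨ν, hν, rfl⟩ := h n hn
  have hf : Measurable fun x : ℝ => a * x + b / n := by fun_prop
  have hν' : IsProbabilityMeasure (ν.map fun x => a * x + b / n) :=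
    Measure.isProbabilityMeasure_map hf.aemeasurable
  refine ⟨ν.map fun x => a * x + b / n, hν', ?_⟩
  have hn' : (n : ℝ) ≠ 0 := by exact_mod_cast (by omega : n ≠ 0)
  rw [← Measure.pi_map_pi (fun _ => hf.aemeasurable),
    Measure.map_map (measurable_sum_coords n) (by fun_prop),
    Measure.map_map (by fun_prop) (measurable_sum_coords n)]
  congr 1
  ext x
  simp only [Function.comp_apply, Finset.sum_add_distrib, Finset.mul_sum]
  simp
  field_simp

/-- If all `n` independent summands exceed `r`, the sum exceeds `n * r`. This transfers tail bounds
from a law to its roots. -/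
theorem measure_Ioi_pow_le {n : ℕ} (hn : 1 ≤ n) {ν μ : Measure ℝ} [IsProbabilityMeasure ν]
    (h : (Measure.pi (fun _ : Fin n => ν)).map (fun x => ∑ i, x i) = μ) (r : ℝ) :
    ν (Ioi r) ^ n ≤ μ (Ioi (n * r)) := by
  rw [← h, Measure.map_apply (measurable_sum_coords n) measurableSet_Ioi]
  calc ν (Ioi r) ^ n = Measure.pi (fun _ : Fin n => ν) (Set.univ.pi fun _ => Ioi r) := by
        rw [Measure.pi_pi]; simp
    _ ≤ _ := by
        refine measure_mono fun x hx => ?_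
        have hne : (Finset.univ : Finset (Fin n)).Nonempty := ⟨⟨0, hn⟩, Finset.mem_univ _⟩
        have := Finset.sum_lt_sum_of_nonempty hne (f := fun _ => r) (g := x) fun i _ => hx i (Set.mem_univ i)
        simpa using this

theorem measure_Iio_pow_le {n : ℕ} (hn : 1 ≤ n) {ν μ : Measure ℝ} [IsProbabilityMeasure ν]
    (h : (Measure.pi (fun _ : Fin n => ν)).map (fun x => ∑ i, x i) = μ) (r : ℝ) :
    ν (Iio r) ^ n ≤ μ (Iio (n * r)) := by
  rw [← h, Measure.map_apply (measurable_sum_coords n) measurableSet_Iio]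
  calc ν (Iio r) ^ n = Measure.pi (fun _ : Fin n => ν) (Set.univ.pi fun _ => Iio r) := by
        rw [Measure.pi_pi]; simp
    _ ≤ _ := by
        refine measure_mono fun x hx => ?_
        have hne : (Finset.univ : Finset (Fin n)).Nonempty := ⟨⟨0, hn⟩, Finset.mem_univ _⟩
        have := Finset.sum_lt_sum_of_nonempty hne (f := x) (g := fun _ => r) fun i _ => hx i (Set.mem_univ i)
        simpa using this

/-! ### Tightness and weak limits. -/

/-- The `n`-th convolution roots of a tight set of laws form a tight set. -/
theorem isTightMeasureSet_roots {S : Set (Measure ℝ)} (hS : IsTightMeasureSet S) {n : ℕ}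
    (hn : 1 ≤ n) {T : Set (Measure ℝ)}
    (hT : ∀ ν ∈ T, IsProbabilityMeasure ν ∧
      (Measure.pi (fun _ : Fin n => ν)).map (fun x => ∑ i, x i) ∈ S) :
    IsTightMeasureSet T := by
  rw [isTightMeasureSet_iff_exists_isCompact_measure_compl_le]
  intro ε hε
  -- Tails of the sum bound the `n`-th power of each root tail, and there are two tails.
  have hε' : 0 < (ε / 2) ^ n := ENNReal.pow_pos (ENNReal.half_pos hε.ne') n
  have h0 := tendsto_measure_norm_gt_of_isTightMeasureSet hS
  rw [ENNReal.tendsto_atTop_zero] at h0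
  obtain ⟨r₀, hr₀⟩ := h0 _ hε'
  -- Nonnegativity of `r` gives `r ≤ n * r`.
  set r := max r₀ 0
  have hr := hr₀ r (le_max_left _ _)
  have hr0 : 0 ≤ r := le_max_right _ _
  have hnr : r ≤ n * r := le_mul_of_one_le_left hr0 (by exact_mod_cast hn)
  refine ⟨Icc (-r) r, isCompact_Icc, fun ν hν => ?_⟩
  obtain ⟨hνp, hνS⟩ := hT ν hν
  have key : ∀ s : Set ℝ, s ⊆ {x | r < ‖x‖} →
      (Measure.pi (fun _ : Fin n => ν)).map (fun x => ∑ i, x i) s ≤ (ε / 2) ^ n := by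
    intro s hs
    refine (measure_mono hs).trans (le_trans ?_ hr)
    exact le_iSup₂ (f := fun μ (_ : μ ∈ S) => μ {x | r < ‖x‖}) _ hνS
  have hn0 : n ≠ 0 := by omega
  have h1 : ν (Ioi r) ≤ ε / 2 := by
    rw [← ENNReal.pow_le_pow_left_iff hn0]
    refine (measure_Ioi_pow_le hn rfl r).trans (key _ fun x hx => ?_)
    exact (hnr.trans_lt hx).trans_le (le_abs_self x)
  have h2 : ν (Iio (-r)) ≤ ε / 2 := by
    rw [← ENNReal.pow_le_pow_left_iff hn0]
    refine (measure_Iio_pow_le hn rfl (-r)).trans (key _ fun x hx => ?_)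
    have hx' : x < n * -r := hx
    have : r < -x := by linarith
    exact this.trans_le (neg_le_abs x)
  calc ν (Icc (-r) r)ᶜ ≤ ν (Ioi r ∪ Iio (-r)) := by
        refine measure_mono fun x hx => ?_
        simp only [mem_compl_iff, mem_Icc, not_and_or, not_le] at hx
        exact hx.symm
    _ ≤ ν (Ioi r) + ν (Iio (-r)) := measure_union_le _ _
    _ ≤ ε / 2 + ε / 2 := add_le_add h1 h2
    _ = ε := ENNReal.add_halves ε

theorem exists_tendsto_of_isTightMeasureSet {ι : Type*} (U : Ultrafilter ι)
    (μs : ι → ProbabilityMeasure ℝ)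
    (h : IsTightMeasureSet (range fun i => (μs i : Measure ℝ))) :
    ∃ μ : ProbabilityMeasure ℝ, Tendsto μs U (𝓝 μ) := by
  have hc : IsCompact (closure (range μs)) := by
    refine isCompact_closure_of_isTightMeasureSet (h.subset ?_)
    rintro _ ⟨_, ⟨i, rfl⟩, rfl⟩
    exact ⟨i, rfl⟩
  obtain ⟨μ, -, hμ⟩ := hc.ultrafilter_le_nhds (U.map μs) (by
    rw [le_principal_iff]
    exact Ultrafilter.mem_map.2 (Filter.univ_mem' fun i => subset_closure ⟨i, rfl⟩))
  exact ⟨μ, hμ⟩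

theorem tendsto_charFun_of_tendsto {ι : Type*} {l : Filter ι}
    {μs : ι → ProbabilityMeasure ℝ} {μ : ProbabilityMeasure ℝ} (h : Tendsto μs l (𝓝 μ)) (t : ℝ) :
    Tendsto (fun i => charFun (μs i : Measure ℝ) t) l (𝓝 (charFun (μ : Measure ℝ) t)) := by
  rw [ProbabilityMeasure.tendsto_iff_forall_integral_rclike_tendsto ℂ] at h
  simp_rw [charFun_eq_integral_innerProbChar]
  exact h (BoundedContinuousFunction.innerProbChar t)

/-- The `n`-th roots are tight, hence converge along the same ultrafilter; the identity between
characteristic functions passes to the limit. -/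
theorem isInfinitelyDivisible_of_tendsto {ι : Type*} (U : Ultrafilter ι)
    {μs : ι → ProbabilityMeasure ℝ} {μ : ProbabilityMeasure ℝ}
    (ht : IsTightMeasureSet (range fun i => (μs i : Measure ℝ)))
    (h : Tendsto μs U (𝓝 μ)) (hd : ∀ i, IsInfinitelyDivisible (μs i : Measure ℝ)) :
    IsInfinitelyDivisible (μ : Measure ℝ) := by
  refine isInfinitelyDivisible_of_charFun fun n hn => ?_
  choose ν hν hνμ using fun i => hd i n hn
  obtain ⟨ν', hν'⟩ := exists_tendsto_of_isTightMeasureSet U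
    (fun i => (⟨ν i, hν i⟩ : ProbabilityMeasure ℝ)) (isTightMeasureSet_roots ht hn (by
      rintro _ ⟨i, rfl⟩
      exact ⟨hν i, i, (hνμ i).symm⟩))
  refine ⟨ν', inferInstance, fun t => ?_⟩
  refine tendsto_nhds_unique ((tendsto_charFun_of_tendsto hν' t).pow n) ?_
  refine (tendsto_charFun_of_tendsto h t).congr fun i => ?_
  have := hν i
  exact (charFun_pow_of_map_sum (hνμ i) t).symm

theorem isTightMeasureSet_of_integral_sq_le {S : Set (Measure ℝ)}
    (h : ∀ μ ∈ S, IsProbabilityMeasure μ ∧ Integrable (fun x => x ^ 2) μ ∧ ∫ x, x ^ 2 ∂μ ≤ 1) :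
    IsTightMeasureSet S := by
  rw [isTightMeasureSet_iff_exists_isCompact_measure_compl_le]
  intro ε hε
  obtain ⟨δ, hδ, hδε⟩ := ENNReal.lt_iff_exists_nnreal_btwn.1 hε
  have hδ0 : (0 : ℝ) < δ := by exact_mod_cast hδ
  -- Chebyshev bounds the mass outside `[-r, r]` by `1 / r ^ 2 = δ`.
  set r : ℝ := √(1 / δ)
  have hr2 : r ^ 2 = 1 / δ := Real.sq_sqrt (by positivity)
  refine ⟨Icc (-r) r, isCompact_Icc, fun μ hμ => ?_⟩
  obtain ⟨hp, hi, hle⟩ := h μ hμ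
  have hm := mul_meas_ge_le_integral_of_nonneg (Eventually.of_forall fun x => sq_nonneg x) hi (r ^ 2)
  have hsub : (Icc (-r) r)ᶜ ⊆ {x : ℝ | r ^ 2 ≤ x ^ 2} := by
    intro x hx
    rw [mem_compl_iff, mem_Icc, ← abs_le, not_le] at hx
    exact sq_le_sq.2 ((abs_of_nonneg (Real.sqrt_nonneg _)).le.trans hx.le)
  have : μ.real (Icc (-r) r)ᶜ ≤ δ := by
    have h1 : μ.real (Icc (-r) r)ᶜ ≤ μ.real {x : ℝ | r ^ 2 ≤ x ^ 2} := measureReal_mono hsub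
    have h2 := hm.trans hle
    rw [hr2] at h2 h1
    rw [one_div, inv_mul_le_iff₀ hδ0, mul_one] at h2
    rw [one_div] at h1
    exact h1.trans h2
  refine le_trans ?_ hδε.le
  rw [← ENNReal.ofReal_coe_nnreal, ← ofReal_measureReal]
  exact ENNReal.ofReal_le_ofReal this

/-! ### Moments of weak limits. -/

theorem tendsto_integral_of_bounded {ι : Type*} {l : Filter ι}
    {μs : ι → ProbabilityMeasure ℝ} {μ : ProbabilityMeasure ℝ} (h : Tendsto μs l (𝓝 μ))
    {f : ℝ → ℝ} (hf : Continuous f) {C : ℝ} (hC : ∀ x, |f x| ≤ C) :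
    Tendsto (fun i => ∫ x, f x ∂(μs i : Measure ℝ)) l (𝓝 (∫ x, f x ∂(μ : Measure ℝ))) :=
  ProbabilityMeasure.tendsto_iff_forall_integral_tendsto.1 h
    (BoundedContinuousFunction.ofNormedAddCommGroup f hf C hC)

theorem integrable_of_bounded {μ : Measure ℝ} [IsProbabilityMeasure μ]
    {f : ℝ → ℝ} (hf : Continuous f) {C : ℝ} (hC : ∀ x, |f x| ≤ C) : Integrable f μ :=
  Integrable.of_bound hf.aestronglyMeasurable C (Eventually.of_forall hC)

/-- A Fatou argument: the truncations `min (x ^ 2) M` are bounded and continuous, so weak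
convergence applies; then `M` increases to infinity. -/
theorem integral_sq_le_of_tendsto {ι : Type*} {l : Filter ι} [l.NeBot]
    {μs : ι → ProbabilityMeasure ℝ} {μ : ProbabilityMeasure ℝ} (h : Tendsto μs l (𝓝 μ))
    (hi : ∀ i, Integrable (fun x => x ^ 2) (μs i : Measure ℝ))
    (hle : ∀ i, ∫ x, x ^ 2 ∂(μs i : Measure ℝ) ≤ 1) :
    Integrable (fun x => x ^ 2) (μ : Measure ℝ) ∧ ∫ x, x ^ 2 ∂(μ : Measure ℝ) ≤ 1 := by
  have hb : ∀ (M : ℕ) (x : ℝ), |min (x ^ 2) M| ≤ M := fun M x => by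
    rw [abs_of_nonneg (le_min (sq_nonneg x) M.cast_nonneg)]
    exact min_le_right _ _
  have hc : ∀ M : ℕ, Continuous fun x : ℝ => min (x ^ 2) (M : ℝ) := fun M => by fun_prop
  have hM : ∀ M : ℕ, ∫ x, min (x ^ 2) (M : ℝ) ∂(μ : Measure ℝ) ≤ 1 := fun M =>
    le_of_tendsto' (tendsto_integral_of_bounded h (hc M) (hb M)) fun i =>
      (integral_mono (integrable_of_bounded (hc M) (hb M)) (hi i)
        fun x => min_le_left _ _).trans (hle i)
  have hlim : Tendsto (fun M : ℕ => ∫⁻ x, ENNReal.ofReal (min (x ^ 2) (M : ℝ)) ∂(μ : Measure ℝ))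
      atTop (𝓝 (∫⁻ x, ENNReal.ofReal (x ^ 2) ∂(μ : Measure ℝ))) := by
    refine lintegral_tendsto_of_tendsto_of_monotone (fun M => by fun_prop)
      (Eventually.of_forall fun x M N hMN => ?_) (Eventually.of_forall fun x => ?_)
    · exact ENNReal.ofReal_le_ofReal (min_le_min le_rfl (by exact_mod_cast hMN))
    · refine tendsto_const_nhds.congr' ?_
      filter_upwards [eventually_ge_atTop ⌈x ^ 2⌉₊] with M hM
      rw [min_eq_left ((Nat.le_ceil _).trans (by exact_mod_cast hM))]
  have hl : ∫⁻ x, ENNReal.ofReal (x ^ 2) ∂(μ : Measure ℝ) ≤ 1 := by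
    refine le_of_tendsto' hlim fun M => ?_
    rw [← ofReal_integral_eq_lintegral_ofReal (integrable_of_bounded (hc M) (hb M))
      (Eventually.of_forall fun x => le_min (sq_nonneg x) M.cast_nonneg)]
    exact ENNReal.ofReal_le_one.2 (hM M)
  have hint : Integrable (fun x => x ^ 2) (μ : Measure ℝ) := by
    refine ⟨by fun_prop, ?_⟩
    rw [hasFiniteIntegral_iff_ofReal (Eventually.of_forall fun x => sq_nonneg x)]
    exact hl.trans_lt ENNReal.one_lt_top
  refine ⟨hint, ?_⟩
  rw [← ENNReal.ofReal_le_one, ofReal_integral_eq_lintegral_ofReal hint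
    (Eventually.of_forall fun x => sq_nonneg x)]
  exact hl

theorem memLp_two_id_of_integrable_sq {μ : Measure ℝ}
    (hi : Integrable (fun x => x ^ 2) μ) : MemLp id 2 μ :=
  (memLp_two_iff_integrable_sq measurable_id.aestronglyMeasurable).2 hi

theorem abs_sub_clip_le {M : ℝ} (hM : 0 < M) (x : ℝ) : |x - max (-M) (min x M)| ≤ x ^ 2 / M := by
  rw [le_div_iff₀ hM]
  rcases le_total x M with h1 | h1
  · rw [min_eq_left h1]
    rcases le_total (-M) x with h2 | h2
    · rw [max_eq_right h2, sub_self, abs_zero, zero_mul]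
      positivity
    · rw [max_eq_left h2, abs_of_nonpos (by linarith)]
      nlinarith
  · rw [min_eq_right h1, max_eq_right (by linarith), abs_of_nonneg (by linarith)]
    nlinarith

/-- The clipping error is uniform over all laws with second moment at most 1, which lets the mean
pass to weak limits. -/
theorem abs_integral_sub_clip_le {μ : Measure ℝ} [IsProbabilityMeasure μ]
    (hi : Integrable (fun x => x ^ 2) μ) (hle : ∫ x, x ^ 2 ∂μ ≤ 1) {M : ℝ} (hM : 0 < M) :
    |∫ x, x ∂μ - ∫ x, max (-M) (min x M) ∂μ| ≤ 1 / M := by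
  have hid : Integrable (fun x : ℝ => x) μ :=
    (memLp_two_id_of_integrable_sq hi).integrable one_le_two
  have hclip : Integrable (fun x : ℝ => max (-M) (min x M)) μ := by
    refine integrable_of_bounded (C := M) (by fun_prop) fun x => abs_le.2 ⟨le_max_left _ _, ?_⟩
    exact max_le (by linarith) (min_le_right _ _)
  rw [← integral_sub hid hclip]
  calc |∫ x, (x - max (-M) (min x M)) ∂μ| ≤ ∫ x, |x - max (-M) (min x M)| ∂μ :=
        abs_integral_le_integral_abs
    _ ≤ ∫ x, x ^ 2 / M ∂μ :=
        integral_mono (hid.sub hclip).abs (hi.div_const M) fun x => abs_sub_clip_le hM x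
    _ ≤ 1 / M := by
        rw [integral_div]
        exact div_le_div_of_nonneg_right hle hM.le

theorem integral_eq_zero_of_tendsto {ι : Type*} {l : Filter ι} [l.NeBot]
    {μs : ι → ProbabilityMeasure ℝ} {μ : ProbabilityMeasure ℝ} (h : Tendsto μs l (𝓝 μ))
    (hi : ∀ i, Integrable (fun x => x ^ 2) (μs i : Measure ℝ))
    (hle : ∀ i, ∫ x, x ^ 2 ∂(μs i : Measure ℝ) ≤ 1)
    (h0 : ∀ i, ∫ x, x ∂(μs i : Measure ℝ) = 0) : ∫ x, x ∂(μ : Measure ℝ) = 0 := by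
  obtain ⟨hi', hle'⟩ := integral_sq_le_of_tendsto h hi hle
  have key : ∀ M : ℝ, 0 < M → |∫ x, x ∂(μ : Measure ℝ)| ≤ 2 / M := by
    intro M hM
    have hlim := tendsto_integral_of_bounded h (f := fun x => max (-M) (min x M)) (by fun_prop)
      (C := M) fun x => abs_le.2 ⟨le_max_left _ _, max_le (by linarith) (min_le_right _ _)⟩
    have h1 : |∫ x, max (-M) (min x M) ∂(μ : Measure ℝ)| ≤ 1 / M :=
      le_of_tendsto' hlim.abs fun i => by
        have := abs_integral_sub_clip_le (hi i) (hle i) hM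
        rwa [h0, zero_sub, abs_neg] at this
    have h2 := abs_integral_sub_clip_le hi' hle' hM
    rw [abs_le] at *
    have : 2 / M = 1 / M + 1 / M := by ring
    constructor <;> linarith [h1.1, h1.2, h2.1, h2.2]
  by_contra hne
  have hpos := abs_pos.2 hne
  -- This `M` turns the bound `2 / M` into half of the absolute mean.
  have := key (4 / |∫ x, x ∂(μ : Measure ℝ)|) (by positivity)
  rw [div_div_eq_mul_div] at this
  linarith

/-! ### Bounded laws and positivity for a single law. -/

/-- A bounded infinitely divisible law is degenerate. -/
theorem variance_eq_zero_of_bounded {μ : Measure ℝ} (h : IsInfinitelyDivisible μ) {C : ℝ}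
    (hb : ∀ᵐ x ∂μ, |x| ≤ C) : variance id μ = 0 := by
  have hup : μ (Ioi C) = 0 := by
    refine measure_mono_null (fun x hx => ?_) (ae_iff.1 hb)
    exact not_le.2 ((mem_Ioi.1 hx).trans_le (le_abs_self x))
  have hdown : μ (Iio (-C)) = 0 := by
    refine measure_mono_null (fun x hx => ?_) (ae_iff.1 hb)
    have hx' : x < -C := hx
    exact not_le.2 (lt_of_lt_of_le (by linarith) (neg_le_abs x))
  -- The `n`-th root lives on `[-C / n, C / n]`, so its variance is at most `(C / n) ^ 2`, and `n`
  -- copies contribute at most `C ^ 2 / n`.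
  have key : ∀ n : ℕ, 1 ≤ n → variance id μ ≤ C ^ 2 / n := by
    intro n hn
    obtain ⟨ν, hν, hνμ⟩ := h n hn
    have hn0 : (0 : ℝ) < n := by exact_mod_cast hn
    have hnn : n ≠ 0 := by omega
    have h1 : ν (Ioi (C / n)) = 0 := by
      have := measure_Ioi_pow_le hn hνμ (C / n)
      rw [mul_div_cancel₀ _ hn0.ne', hup] at this
      exact pow_eq_zero_iff hnn |>.1 (nonpos_iff_eq_zero.1 this)
    have h2 : ν (Iio (-(C / n))) = 0 := by
      have := measure_Iio_pow_le hn hνμ (-(C / n))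
      rw [mul_neg, mul_div_cancel₀ _ hn0.ne', hdown] at this
      exact pow_eq_zero_iff hnn |>.1 (nonpos_iff_eq_zero.1 this)
    have hνb : ∀ᵐ x ∂ν, x ∈ Icc (-(C / n)) (C / n) := by
      refine measure_mono_null (fun x hx => ?_) (measure_union_null h1 h2)
      simp only [mem_compl_iff, mem_ofPred_eq, mem_Icc, not_and_or, not_le] at hx
      exact hx.symm
    have hvar := variance_le_sq_of_bounded hνb aemeasurable_id
    have hL : MemLp (id : ℝ → ℝ) 2 ν :=
      memLp_of_bounded hνb measurable_id.aestronglyMeasurable 2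
    have hsum : variance id μ = n * variance id ν := by
      rw [← hνμ, variance_map measurable_id.aemeasurable (measurable_sum_coords n).aemeasurable]
      have := variance_sum_pi (μ := fun _ : Fin n => ν) (X := fun _ => id) fun _ => hL
      simp only [Finset.sum_const, Finset.card_univ, Fintype.card_fin, nsmul_eq_mul] at this
      rw [← this]
      congr 1
      ext x
      simp
    rw [hsum]
    calc n * variance id ν ≤ n * ((C / n - -(C / n)) / 2) ^ 2 := by gcongr; exact hvar
      _ = C ^ 2 / n := by field_simp; ring
  refine le_antisymm (ge_of_tendsto (tendsto_const_div_atTop_nhds_zero_nat (C ^ 2)) ?_)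
    (variance_nonneg _ _)
  filter_upwards [eventually_ge_atTop 1] with n hn using key n hn

/-- An infinitely divisible law with finite second moment, mean `0` and second moment `1`. -/
structure IsStandardInfDiv (μ : Measure ℝ) : Prop where
  infinitelyDivisible : IsInfinitelyDivisible μ
  integrable_sq : Integrable (fun x => x ^ 2) μ
  integral_eq_zero : ∫ x, x ∂μ = 0
  integral_sq_eq_one : ∫ x, x ^ 2 ∂μ = 1

theorem variance_id_of_integral_eq_zero {μ : Measure ℝ} (h0 : ∫ x, x ∂μ = 0) :
    variance id μ = ∫ x, x ^ 2 ∂μ :=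
  variance_of_integral_eq_zero measurable_id.aemeasurable h0

theorem IsStandardInfDiv.measure_Ioo_pos {μ : Measure ℝ} [IsProbabilityMeasure μ]
    (h : IsStandardInfDiv μ) : 0 < μ.real (Ioo (-1) 1) := by
  by_contra hcon
  have hz : μ (Ioo (-1) 1) = 0 :=
    (measureReal_eq_zero_iff).1 (le_antisymm (not_lt.1 hcon) measureReal_nonneg)
  -- A nonnegative function with integral 0 vanishes almost everywhere, which forces `|x| = 1`.
  have hge : 0 ≤ᵐ[μ] fun x => x ^ 2 - 1 := by
    refine measure_mono_null (fun x hx => ?_) hz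
    simp only [mem_compl_iff, mem_ofPred_eq, Pi.zero_apply, sub_nonneg, not_le,
      sq_lt_one_iff_abs_lt_one] at hx
    exact abs_lt.1 hx
  have hint : Integrable (fun x => x ^ 2 - 1) μ := h.integrable_sq.sub (integrable_const _)
  have hzero : ∫ x, (x ^ 2 - 1) ∂μ = 0 := by
    rw [integral_sub h.integrable_sq (integrable_const _), h.integral_sq_eq_one]
    simp
  have hae := (integral_eq_zero_iff_of_nonneg_ae hge hint).1 hzero
  have hb : ∀ᵐ x ∂μ, |x| ≤ 1 := by
    filter_upwards [hae] with x hx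
    have : x ^ 2 - 1 = 0 := hx
    exact (sq_le_one_iff_abs_le_one x).1 (by linarith)
  have hv := variance_eq_zero_of_bounded h.infinitelyDivisible hb
  rw [variance_id_of_integral_eq_zero h.integral_eq_zero, h.integral_sq_eq_one] at hv
  exact one_ne_zero hv

/-! ### Passing between random variables and laws on the line. -/

theorem InfDivL2Pos.exists_standardized {Ω : Type u} [MeasurableSpace Ω] {X : Ω → ℝ}
    {P : Measure Ω} [IsProbabilityMeasure P] (h : InfDivL2Pos X P) :
    ∃ μ : ProbabilityMeasure ℝ, IsStandardInfDiv (μ : Measure ℝ) ∧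
      probLt X P = (μ : Measure ℝ).real (Ioo (-1) 1) := by
  set m := ∫ ω, X ω ∂P with hm
  set σ := √(variance X P) with hσ
  have hX := h.measurable
  have hσ0 : 0 < σ := Real.sqrt_pos.2 h.variance_pos
  have hσ2 : σ ^ 2 = variance X P := Real.sq_sqrt h.variance_pos.le
  have hXi : Integrable X P := h.memLp_two.integrable one_le_two
  have hZ : Measurable fun ω => σ⁻¹ * X ω + -(σ⁻¹ * m) := by fun_prop
  have hp : IsProbabilityMeasure (P.map fun ω => σ⁻¹ * X ω + -(σ⁻¹ * m)) :=
    Measure.isProbabilityMeasure_map hZ.aemeasurable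
  have hZ2 : MemLp (fun ω => σ⁻¹ * X ω + -(σ⁻¹ * m)) 2 P :=
    (h.memLp_two.const_mul _).add (memLp_const _)
  refine ⟨⟨_, hp⟩, ⟨?_, ?_, ?_, ?_⟩, ?_⟩
  · have := h.infinitelyDivisible.map_affine σ⁻¹ (-(σ⁻¹ * m))
    rwa [Measure.map_map (by fun_prop) hX] at this
  · exact (integrable_map_measure (by fun_prop) hZ.aemeasurable).2 hZ2.integrable_sq
  · change ∫ x, x ∂(P.map fun ω => σ⁻¹ * X ω + -(σ⁻¹ * m)) = 0
    rw [integral_map hZ.aemeasurable (by fun_prop),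
      integral_add (hXi.const_mul _) (integrable_const _), integral_const_mul]
    simp [← hm]
  · change ∫ x, x ^ 2 ∂(P.map fun ω => σ⁻¹ * X ω + -(σ⁻¹ * m)) = 1
    rw [integral_map hZ.aemeasurable (by fun_prop)]
    have : ∀ ω, (σ⁻¹ * X ω + -(σ⁻¹ * m)) ^ 2 = (σ ^ 2)⁻¹ * (X ω - m) ^ 2 := fun ω => by
      rw [← inv_pow]; ring
    simp_rw [this]
    rw [integral_const_mul, ← variance_eq_integral hX.aemeasurable, hσ2,
      inv_mul_cancel₀ h.variance_pos.ne']
  · change _ = (P.map fun ω => σ⁻¹ * X ω + -(σ⁻¹ * m)).real (Ioo (-1) 1)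
    rw [map_measureReal_apply hZ measurableSet_Ioo, probLt, ← hσ, ← hm]
    congr 1
    ext ω
    have : σ⁻¹ * X ω + -(σ⁻¹ * m) = (X ω - m) / σ := by ring
    simp only [mem_ofPred_eq, mem_preimage, this, mem_Ioo]
    rw [← abs_lt, abs_div, abs_of_pos hσ0, div_lt_one hσ0]

/-- Realisation of a centred law on the real line as the law of a random variable. -/
theorem exists_realisation {μ : Measure ℝ} [IsProbabilityMeasure μ]
    (hd : IsInfinitelyDivisible μ) (hi : Integrable (fun x => x ^ 2) μ) (h0 : ∫ x, x ∂μ = 0)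
    (hpos : 0 < ∫ x, x ^ 2 ∂μ) :
    ∃ (Ω : Type u) (_ : MeasurableSpace Ω) (P : Measure Ω) (Y : Ω → ℝ),
      IsProbabilityMeasure P ∧ InfDivL2Pos Y P ∧
      probLt Y P = μ.real {x | |x| < √(∫ x, x ^ 2 ∂μ)} := by
  have hup : Measurable (ULift.up : ℝ → ULift.{u} ℝ) := measurable_up
  have hY : Measurable (ULift.down : ULift.{u} ℝ → ℝ) := measurable_down
  have hmap : (μ.map (ULift.up : ℝ → ULift.{u} ℝ)).map ULift.down = μ := by
    rw [Measure.map_map hY hup]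
    exact Measure.map_id
  have hvar : variance (ULift.down : ULift.{u} ℝ → ℝ) (μ.map ULift.up) = ∫ x, x ^ 2 ∂μ := by
    rw [variance_map hY.aemeasurable hup.aemeasurable]
    exact variance_id_of_integral_eq_zero h0
  have hmean : ∫ ω, ULift.down ω ∂(μ.map (ULift.up : ℝ → ULift.{u} ℝ)) = 0 := by
    rw [integral_map hup.aemeasurable hY.aestronglyMeasurable]
    exact h0
  -- `ULift` places the sample space in the prescribed universe.
  refine ⟨ULift.{u} ℝ, inferInstance, μ.map ULift.up, ULift.down,
    Measure.isProbabilityMeasure_map hup.aemeasurable, ⟨⟨hY, ?_, ?_⟩, ?_⟩, ?_⟩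
  · rw [memLp_map_measure_iff hY.aestronglyMeasurable hup.aemeasurable]
    exact memLp_two_id_of_integrable_sq hi
  · rwa [hmap]
  · rwa [hvar]
  · rw [probLt, hvar, hmean, map_measureReal_apply hup
      (measurableSet_lt (by fun_prop) measurable_const)]
    simp

/-- The standard Gaussian makes both sets of values nonempty; the `sInf` of an empty set of reals
would be 0. -/
theorem exists_infDivL2Pos :
    ∃ (Ω : Type u) (_ : MeasurableSpace Ω) (P : Measure Ω) (Y : Ω → ℝ),
      IsProbabilityMeasure P ∧ InfDivL2Pos Y P := by
  have h0 : ∫ x, x ∂(gaussianReal 0 1) = 0 := integral_id_gaussianReal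
  have h1 : ∫ x, x ^ 2 ∂(gaussianReal 0 1) = 1 := by
    rw [← variance_id_of_integral_eq_zero h0, variance_id_gaussianReal]
    rfl
  have hi : Integrable (fun x => x ^ 2) (gaussianReal 0 1) :=
    (memLp_id_gaussianReal 2).integrable_sq
  obtain ⟨Ω, _, P, Y, hP, hY, -⟩ := exists_realisation isInfinitelyDivisible_gaussianReal hi h0
    (by rw [h1]; exact one_pos)
  exact ⟨Ω, _, P, Y, hP, hY⟩

/-! ### The infimum: attainment and comparison. -/

theorem infProbLt_le {Ω : Type u} [MeasurableSpace Ω] {X : Ω → ℝ} {P : Measure Ω}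
    [hP : IsProbabilityMeasure P] (h : InfDivL2Pos X P) : infProbLt.{u} ≤ probLt X P :=
  csInf_le ⟨0, by rintro _ ⟨_, _, _, _, _, _, rfl⟩; exact measureReal_nonneg⟩
    ⟨Ω, _, P, X, hP, h, rfl⟩

theorem infProbLt_le_one : infProbLt.{u} ≤ 1 := by
  obtain ⟨Ω, _, P, Y, _, hY⟩ := exists_infDivL2Pos.{u}
  exact (infProbLt_le hY).trans measureReal_le_one

theorem exists_infProbLt_eq :
    ∃ (Ω : Type u) (_ : MeasurableSpace Ω) (P : Measure Ω) (Y : Ω → ℝ),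
      IsProbabilityMeasure P ∧ InfDivL2Pos Y P ∧ infProbLt.{u} = probLt Y P := by
  obtain ⟨p, -, hp, hmem⟩ := exists_seq_tendsto_sInf
    (S := {p : ℝ | ∃ (Ω : Type u) (_ : MeasurableSpace Ω) (P : Measure Ω) (X : Ω → ℝ),
      IsProbabilityMeasure P ∧ InfDivL2Pos X P ∧ p = probLt X P})
    (by
      obtain ⟨Ω, _, P, Y, hP, hY⟩ := exists_infDivL2Pos.{u}
      exact ⟨_, Ω, _, P, Y, hP, hY, rfl⟩)
    ⟨0, by rintro _ ⟨_, _, _, _, _, _, rfl⟩; exact measureReal_nonneg⟩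
  have hstd : ∀ k, ∃ μ : ProbabilityMeasure ℝ, IsStandardInfDiv (μ : Measure ℝ) ∧
      p k = (μ : Measure ℝ).real (Ioo (-1) 1) := fun k => by
    obtain ⟨Ω, _, P, X, hP, hX, h⟩ := hmem k
    rw [h]
    exact hX.exists_standardized
  choose μs hμs hpμ using hstd
  have htight : IsTightMeasureSet (range fun k => (μs k : Measure ℝ)) := by
    refine isTightMeasureSet_of_integral_sq_le ?_
    rintro _ ⟨k, rfl⟩
    exact ⟨inferInstance, (hμs k).integrable_sq, (hμs k).integral_sq_eq_one.le⟩
  obtain ⟨μ, hμ⟩ := exists_tendsto_of_isTightMeasureSet (hyperfilter ℕ) μs htight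
  have hpU : Tendsto p (hyperfilter ℕ) (𝓝 infProbLt.{u}) :=
    hp.mono_left Nat.hyperfilter_le_atTop
  have hd := isInfinitelyDivisible_of_tendsto _ htight hμ fun k => (hμs k).infinitelyDivisible
  obtain ⟨hi, hle⟩ := integral_sq_le_of_tendsto hμ (fun k => (hμs k).integrable_sq)
    fun k => (hμs k).integral_sq_eq_one.le
  have h0 := integral_eq_zero_of_tendsto hμ (fun k => (hμs k).integrable_sq)
    (fun k => (hμs k).integral_sq_eq_one.le) fun k => (hμs k).integral_eq_zero
  have hport : (μ : Measure ℝ).real (Ioo (-1) 1) ≤ infProbLt.{u} := by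
    have h1 := ProbabilityMeasure.le_liminf_measure_open_of_tendsto hμ
      (isOpen_Ioo (a := (-1 : ℝ)) (b := 1))
    have h2 : Tendsto (fun k => (μs k : Measure ℝ) (Ioo (-1) 1)) (hyperfilter ℕ)
        (𝓝 (ENNReal.ofReal infProbLt.{u})) := by
      refine ((ENNReal.continuous_ofReal.tendsto _).comp hpU).congr fun k => ?_
      rw [Function.comp_apply, hpμ, ofReal_measureReal]
    rw [h2.liminf_eq] at h1
    have hnn : 0 ≤ infProbLt.{u} := ge_of_tendsto' hpU fun k => hpμ k ▸ measureReal_nonneg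
    exact ENNReal.toReal_le_of_le_ofReal hnn h1
  rcases (integral_nonneg fun x => sq_nonneg x : 0 ≤ ∫ x, x ^ 2 ∂(μ : Measure ℝ)).eq_or_lt
    with hs | hs
  -- All variance was lost: the limit sits at 0, so the infimum is at least 1 and any member of the
  -- class attains it.
  · have hae := (integral_eq_zero_iff_of_nonneg (fun x => sq_nonneg x) hi).1 hs.symm
    have hone : (μ : Measure ℝ).real (Ioo (-1) 1) = 1 := by
      rw [measureReal_def, (mem_ae_iff_prob_eq_one measurableSet_Ioo).1, ENNReal.toReal_one]
      filter_upwards [hae] with x hx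
      have hx0 : x = 0 := by simpa using hx
      simp [hx0]
    obtain ⟨Ω, _, P, Y, hP, hY⟩ := exists_infDivL2Pos.{u}
    exact ⟨Ω, _, P, Y, hP, hY, le_antisymm (infProbLt_le hY)
      (measureReal_le_one.trans (hone.symm.le.trans hport))⟩
  · obtain ⟨Ω, _, P, Y, hP, hY, hYμ⟩ := exists_realisation.{u} hd hi h0 hs
    refine ⟨Ω, _, P, Y, hP, hY, le_antisymm (infProbLt_le hY) ?_⟩
    rw [hYμ]
    refine le_trans (measureReal_mono fun x hx => ?_) hport
    exact abs_lt.1 (lt_of_lt_of_le hx (Real.sqrt_le_one.2 hle))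

theorem infProbLt_le_infProbLe : infProbLt.{u} ≤ infProbLe.{u} := by
  refine le_csInf ?_ ?_
  · obtain ⟨Ω, _, P, Y, hP, hY⟩ := exists_infDivL2Pos.{u}
    exact ⟨_, Ω, _, P, Y, hP, hY.toInfDivL2, rfl⟩
  · rintro _ ⟨Ω, _, P, X, hP, hX, rfl⟩
    rcases (variance_nonneg X P).eq_or_lt with hv | hv
    -- Zero variance makes `X` almost surely equal to its mean, and the non-strict event then has
    -- full probability.
    · have hone : probLe X P = 1 := by
        have hev : evariance X P = 0 := by
          rw [← hX.memLp_two.ofReal_variance_eq, ← hv, ENNReal.ofReal_zero]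
        have hae := (evariance_eq_zero_iff hX.measurable.aemeasurable).1 hev
        have hXm := hX.measurable
        rw [probLe, measureReal_def, (mem_ae_iff_prob_eq_one (measurableSet_le (by fun_prop)
          measurable_const)).1, ENNReal.toReal_one]
        filter_upwards [hae] with ω hω
        simp [hω]
      rw [hone]
      exact infProbLt_le_one
    · refine (infProbLt_le ⟨hX, hv⟩).trans (measureReal_mono fun ω hω => ?_)
      simp only [mem_ofPred_eq] at hω ⊢
      exact hω.le

theorem theorem2p1 :
    infProbLt.{u} ≤ infProbLe.{u} ∧ 0 < infProbLt.{u} ∧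
    ∃ (Ω : Type u) (_ : MeasurableSpace Ω) (P : Measure Ω) (Y : Ω → ℝ),
      IsProbabilityMeasure P ∧ InfDivL2Pos Y P ∧ infProbLt.{u} = probLt Y P := by
  refine ⟨infProbLt_le_infProbLe, ?_, exists_infProbLt_eq⟩
  obtain ⟨Ω, _, P, Y, _, hY, h⟩ := exists_infProbLt_eq.{u}
  obtain ⟨μ, hμ, hμY⟩ := hY.exists_standardized
  rw [h, hμY]
  exact hμ.measure_Ioo_pos
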